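/- Let $\mathbb{F}_q$ be a finite field of order $q$ and characteristic $p$. An arc in $\mathbb{F}_q^k$ is an ordered family of at least $k$ vectors in which every subfamily of size $k$ is a basis of $\mathbb{F}_q^k$. For an arc $G\subset\mathbb{F}_q^k$ with $k\ge 2$, a basis $B$ of $\mathbb{F}_q^k$ and $0\le n\le |G|-k+1$, let $M_G^{\uparrow n}$ be the matrix over $\mathbb{F}_q$ with rows indexed by $C\in\binom{G}{k-1}$, columns indexed by pairs $(U,A)$ with $U\in\binom{G}{n}$ and $A\in\binom{G\setminus U}{k-2}$, and $(C,(U,A))$-entry $\prod_{u\in U}\det(u,C)_B$ if $A\subset C\subset G\setminus U$ and $0$ otherwise; here $\det(u,C)_B$ is the determinant of the matrix whose first row is $u$ and whose last $k-1$ rows are the elements of $C$, in the order inherited from $G$, all written with respect to $B$. Let $I_r(a,b)$ be the inclusion matrix over $\mathbb{F}_q$, with rows indexed by the $a$-subsets $A$ of $\{1,\dots,r\}$, columns indexed by the $b$-subsets $B'$ of $\{1,\dots,r\}$, and $(A,B')$-entry $1$ if $B'\subset A$ and $0$ otherwise. (1) If $G\subset\mathbb{F}_q^k$ is an arc of size $2k-3$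 (so $k\ge 3$) and $B$ is any basis of $\mathbb{F}_q^k$, then, after identifying the column index $(\emptyset,A)$ with $A$ and the members of $G$ with their positions $1,\dots,2k-3$, $M_G^{\uparrow 0}=I_{2k-3}(k-1,k-2)$, and this matrix has full row rank if and only if $k\le p$. (2) If $2\le k\le p$, then the maximum size $g(k,q)$ of an arc in $\mathbb{F}_q^k$ exists and equals $q+1$. -/

import Mathlib

namespace ArcMDS

/-- An arc of size `m` in `F ^ k`: an ordered family of `m ≥ k` vectors every subfamily of size `k`
of which is a basis of `F ^ k`. -/
def IsArc {F : Type*} [Field F] {m k : ℕ} (G : Fin m → (Fin k → F)) : Prop :=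
  k ≤ m ∧ ∀ T : Finset (Fin m), T.card = k →
    LinearIndependent F (fun i : T => G i) ∧ Submodule.span F (Set.range fun i : T => G i) = ⊤

/-- The sizes of arcs in `F ^ k`. The number `g(k, q)` is the greatest element of this set. -/
def arcSizes (F : Type*) [Field F] (k : ℕ) : Set ℕ :=
  {m | ∃ G : Fin m → (Fin k → F), IsArc G}

/-- Subsets of `{0, …, r - 1}` of size `a`. -/
abbrev Subsets (r a : ℕ) : Type := {C : Finset (Fin r) // C.card = a}

/-- The inclusion matrix `I_r(a, b)` over `F`. -/
def inclusionMatrix (F : Type*) [Field F] (r a b : ℕ) : Matrix (Subsets r a) (Subsets r b) F :=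
  Matrix.of fun A B => if B.1 ⊆ A.1 then 1 else 0

/-- `det (u, C)_B`: the determinant of the matrix whose first row is `u` in coordinates with
respect to `B`, and whose other `k - 1` rows are the vectors of `G` at the positions in `C`,
in the order inherited from `G`, in coordinates with respect to `B`. -/
noncomputable def detWith {F : Type*} [Field F] {m k : ℕ} (G : Fin m → (Fin k → F))
    (B : Module.Basis (Fin k) F (Fin k → F)) (u : Fin k → F) (C : Subsets m (k - 1)) : F :=
  Matrix.det (Matrix.of fun i j : Fin k =>
    B.repr (if h : i.1 = 0 then u
      else G (C.1.orderEmbOfFin C.2 ⟨i.1 - 1, by have := i.2; omega⟩)) j)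

/-- Column indices of `M_G^{↑n}`: pairs `(U, A)` with `U` an `n`-subset of the (positions of the)
arc and `A` a `(k - 2)`-subset of the complement of `U`. Used for `k ≥ 2` only. -/
abbrev ColIndex (m k n : ℕ) : Type :=
  {UA : Finset (Fin m) × Finset (Fin m) //
    UA.1.card = n ∧ UA.2.card = k - 2 ∧ UA.2 ⊆ Finset.univ \ UA.1}

/-- The matrix `M_G^{↑n}` computed with the basis `B`. -/
noncomputable def arcMatrix {F : Type*} [Field F] {m k : ℕ} (G : Fin m → (Fin k → F))
    (B : Module.Basis (Fin k) F (Fin k → F)) (n : ℕ) :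
    Matrix (Subsets m (k - 1)) (ColIndex m k n) F :=
  Matrix.of fun C UA =>
    if UA.1.2 ⊆ C.1 ∧ C.1 ⊆ Finset.univ \ UA.1.1 then ∏ u ∈ UA.1.1, detWith G B (G u) C else 0

/-- The rank of the matrix equals its number of rows. -/
def HasFullRowRank {F : Type*} [Field F] {r c : Type*} [Fintype r] [Fintype c]
    (M : Matrix r c F) : Prop :=
  M.rank = Fintype.card r

end ArcMDS

/-! Part (1). With `n = 0` the products are empty, so the matrix is an inclusion matrix. With `k = b
+ 2`, a vector `y` in its left kernel has zero sum over the `(b + 1)`-sets containing any given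
`b`-set. If `1, …, b + 1` are invertible, double counting carries this down to all smaller sets, and
inclusion-exclusion over the complement of `C` isolates `y C = 0` (`eq_zero_of_sum_insert_eq_zero`).
If `p ≤ b + 1`, a product of `b + 1 - p` differences of indicators is a nonzero kernel vector
(`sum_pairProd_insert`).

Part (2). The normal rational curve attains `q + 1`. Suppose an arc has `q + 2` vectors, and choose
`2k - 3` of them, `G`. To a `(k - 1)`-subset `C` of `G` attach the inverse of the product of `det(u,
C)` over all `u` outside `C`, with `u ∈ G` counted twice. Projecting from a `(k - 2)`-subset turns
these determinants into differences of points on an affine line, and Lagrange interpolation puts the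
weights in the left kernel of the inclusion matrix (`sum_inv_detProd_eq_zero`). As `k ≤ p` they must
vanish, yet they are inverses of nonzero numbers. Choosing `G` and one further vector needs `2k ≤ q
+ 4`; larger `k` reduce to this by duality. -/

open Finset

namespace ArcMDS

/-! ### Left kernels of inclusion matrices. -/

section InclusionMatrix

variable {α F : Type*} [DecidableEq α] [Field F]

/-- Sum of `y` over the `n`-subsets of `R` containing `A`. -/
def supersetSum (R : Finset α) (n : ℕ) (y : Finset α → F) (A : Finset α) : F :=
  ∑ C ∈ R.powersetCard n, if A ⊆ C then y C else 0

theorem supersetSum_of_card_eq {R C : Finset α} {n : ℕ} (y : Finset α → F) (hC : C ⊆ R)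
    (hc : C.card = n) : supersetSum R n y C = y C := by
  rw [supersetSum, sum_eq_single C]
  · simp
  · intro D hD hne
    rw [mem_powersetCard] at hD
    rw [if_neg]
    intro h
    exact hne (eq_of_subset_of_card_le h (by omega)).symm
  · intro h
    exact absurd (mem_powersetCard.2 ⟨hC, hc⟩) h

/-- Double counting: an `n`-set `C` containing `A` is counted once for each `e ∈ C \ A`. -/
theorem sum_supersetSum_insert {R A : Finset α} (n : ℕ) (y : Finset α → F) :
    ∑ e ∈ R \ A, supersetSum R n y (insert e A) = ((n - A.card : ℕ) : F) * supersetSum R n y A := by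
  simp only [supersetSum]
  rw [sum_comm, mul_sum]
  refine sum_congr rfl fun C hC => ?_
  rw [mem_powersetCard] at hC
  by_cases hAC : A ⊆ C
  · have h : (R \ A).filter (fun e => insert e A ⊆ C) = C \ A := by
      ext e
      simp only [mem_filter, mem_sdiff, insert_subset_iff]
      constructor
      · rintro ⟨⟨_, h1⟩, h2, _⟩
        exact ⟨h2, h1⟩
      · rintro ⟨h1, h2⟩
        exact ⟨⟨hC.1 h1, h2⟩, h1, hAC⟩
    rw [← sum_filter, h, sum_const, card_sdiff_of_subset hAC, hC.2, if_pos hAC, nsmul_eq_mul]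
  · rw [if_neg hAC, mul_zero]
    exact sum_eq_zero fun e _ => if_neg fun h => hAC ((subset_insert e A).trans h)

/-- Downward induction on the size of `A`, with `d = n - 1 - A.card`: each step divides by `n -
A.card`, one of the invertible numbers `1, …, n`. -/
theorem supersetSum_eq_zero {R : Finset α} {n : ℕ}
    (hinv : ∀ i : ℕ, 0 < i → i ≤ n → (i : F) ≠ 0) {y : Finset α → F}
    (hy : ∀ A ⊆ R, A.card + 1 = n → ∑ e ∈ R \ A, y (insert e A) = 0) (d : ℕ) :
    ∀ A ⊆ R, A.card + d + 1 = n → supersetSum R n y A = 0 := by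
  have key : ∀ A ⊆ R, A.card < n → ∑ e ∈ R \ A, supersetSum R n y (insert e A) = 0 →
      supersetSum R n y A = 0 := by
    intro A _ hlt h
    rw [sum_supersetSum_insert] at h
    exact (mul_eq_zero.1 h).resolve_left (hinv _ (by omega) (by omega))
  induction d with
  | zero =>
    intro A hA hc
    refine key A hA (by omega) ?_
    rw [← hy A hA (by omega)]
    refine sum_congr rfl fun e he => supersetSum_of_card_eq y ?_ ?_
    · exact insert_subset (mem_sdiff.1 he).1 hA
    · rw [card_insert_of_notMem (mem_sdiff.1 he).2]; omega
  | succ d ih =>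
    intro A hA hc
    refine key A hA (by omega) (sum_eq_zero fun e he => ih _ ?_ ?_)
    · exact insert_subset (mem_sdiff.1 he).1 hA
    · rw [card_insert_of_notMem (mem_sdiff.1 he).2]; omega

/-- Inclusion-exclusion: the signed count of the subsets of `D ∩ C` is zero unless `D ∩ C` is empty.
-/
theorem sum_powerset_supersetSum {R : Finset α} (n : ℕ) (y : Finset α → F) (D : Finset α) :
    ∑ S ∈ D.powerset, (-1) ^ S.card * supersetSum R n y S =
      ∑ C ∈ R.powersetCard n, if D ∩ C = ∅ then y C else 0 := by
  simp only [supersetSum, mul_sum]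
  rw [sum_comm]
  refine sum_congr rfl fun C _ => ?_
  have h : D.powerset.filter (fun S => S ⊆ C) = (D ∩ C).powerset := by
    ext S
    rw [mem_filter, mem_powerset, mem_powerset, subset_inter_iff]
  have h2 := congrArg (Int.cast : ℤ → F) (sum_powerset_neg_one_pow_card (x := D ∩ C))
  push_cast at h2
  simp only [mul_ite, mul_zero]
  rw [← sum_filter, h, ← sum_mul, h2]
  split_ifs <;> simp

/-- The inclusion matrix of `n`-subsets against `(n - 1)`-subsets of a `(2 n - 1)`-set has trivial
left kernel when `1, …, n` are invertible. -/
theorem eq_zero_of_sum_insert_eq_zero {R : Finset α} {n : ℕ} (hR : R.card + 1 = 2 * n)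
    (hinv : ∀ i : ℕ, 0 < i → i ≤ n → (i : F) ≠ 0) {y : Finset α → F}
    (hy : ∀ A ⊆ R, A.card + 1 = n → ∑ e ∈ R \ A, y (insert e A) = 0)
    {C : Finset α} (hC : C ⊆ R) (hc : C.card = n) : y C = 0 := by
  -- All subsets of `R \ C` have fewer than `n` elements, so their superset sums vanish, while `C`
  -- is the only `n`-subset of `R` disjoint from `R \ C`.
  have hcard : (R \ C).card + 1 = n := by rw [card_sdiff_of_subset hC]; omega
  have h := sum_powerset_supersetSum (R := R) n y (R \ C)
  rw [sum_eq_zero, sum_eq_single C] at h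
  · simpa using h.symm
  · intro D hD hne
    rw [mem_powersetCard] at hD
    rw [if_neg]
    intro h0
    refine hne (eq_of_subset_of_card_le (fun x hx => ?_) (by omega))
    by_contra hxC
    have : x ∈ (R \ C) ∩ D := mem_inter.2 ⟨mem_sdiff.2 ⟨hD.1 hx, hxC⟩, hx⟩
    simp [h0] at this
  · intro h0
    exact absurd (mem_powersetCard.2 ⟨hC, hc⟩) h0
  · intro S hS
    rw [mem_powerset] at hS
    have := card_le_card hS
    rw [supersetSum_eq_zero hinv hy (n - 1 - S.card) S (hS.trans sdiff_subset) (by omega), mul_zero]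

/-- The product over `j` of `[x j ∈ C] - [z j ∈ C]`. -/
def pairProd {i : ℕ} (x z : Fin i → α) (C : Finset α) : F :=
  ∏ j, ((if x j ∈ C then 1 else 0) - (if z j ∈ C then 1 else 0))

theorem pairProd_insert_of_notMem {i : ℕ} {x z : Fin i → α} {A : Finset α} {e : α}
    (hx : ∀ j, e ≠ x j) (hz : ∀ j, e ≠ z j) :
    pairProd x z (insert e A) = (pairProd x z A : F) := by
  refine prod_congr rfl fun j _ => ?_
  simp [mem_insert, (hx j).symm, (hz j).symm]

theorem pairProd_eq_zero_of_mem {i : ℕ} {x z : Fin i → α} {A : Finset α} {j : Fin i}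
    (h : x j ∈ A ↔ z j ∈ A) : (pairProd x z A : F) = 0 :=
  prod_eq_zero (mem_univ j) (by simp [h])

/-- If a pair misses `A`, only its two points contribute, with opposite signs; if a pair lies in
`A`, all terms vanish. Otherwise each pair meets `A` once: adding any of the `i` missing partners
gives zero, and the other terms are equal, their number being zero in `F`. -/
theorem sum_pairProd_insert {i : ℕ} {x z : Fin i → α} (hx : Function.Injective x)
    (hz : Function.Injective z) (hxz : ∀ j l, x j ≠ z l) {R A : Finset α}
    (hxR : ∀ j, x j ∈ R) (hzR : ∀ j, z j ∈ R)
    (hcard : (((R \ A).card - i : ℕ) : F) = 0) :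
    ∑ e ∈ R \ A, (pairProd x z (insert e A) : F) = 0 := by
  by_cases h1 : ∃ j, x j ∉ A ∧ z j ∉ A
  · obtain ⟨j, hxj, hzj⟩ := h1
    have hsub : {x j, z j} ⊆ R \ A := by
      simp [insert_subset_iff, hxR, hzR, hxj, hzj]
    rw [← sum_subset hsub, sum_pair (hxz j j)]
    · simp only [pairProd]
      rw [← mul_prod_erase univ _ (mem_univ j), ← mul_prod_erase univ _ (mem_univ j)]
      rw [prod_congr rfl (g := fun l : Fin i => ((if x l ∈ insert (z j) A then (1 : F) else 0) -
        (if z l ∈ insert (z j) A then 1 else 0)))]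
      · simp [hxj, hzj, hxz, (hxz j j).symm]
      · intro l hl
        have hlj := (mem_erase.1 hl).1
        simp [hx.ne hlj, hz.ne hlj, hxz, (hxz j l).symm]
    · intro e _ he
      simp only [mem_insert, mem_singleton, not_or] at he
      refine pairProd_eq_zero_of_mem (j := j) ?_
      simp [mem_insert, hxj, hzj, Ne.symm he.1, Ne.symm he.2]
  push Not at h1
  by_cases h2 : ∃ j, x j ∈ A ∧ z j ∈ A
  · obtain ⟨j, hxj, hzj⟩ := h2
    refine sum_eq_zero fun e _ => pairProd_eq_zero_of_mem (j := j) ?_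
    simp [hxj, hzj]
  push Not at h2
  set w : Fin i → α := fun j => if x j ∈ A then z j else x j with hw
  have hwA : ∀ j, w j ∈ R \ A := by
    intro j
    by_cases h : x j ∈ A
    · simp [hw, h, hzR, h2 j h]
    · simp [hw, h, hxR]
  have hwinj : Function.Injective w := by
    intro j l hjl
    simp only [hw] at hjl
    split_ifs at hjl
    · exact hz hjl
    · exact absurd hjl.symm (hxz _ _)
    · exact absurd hjl (hxz _ _)
    · exact hx hjl
  have hsub : univ.image w ⊆ R \ A := image_subset_iff.2 fun j _ => hwA j
  rw [← sum_sdiff hsub, sum_image hwinj.injOn, sum_congr rfl (g := fun _ => (pairProd x z A : F)),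
    sum_const, card_sdiff_of_subset hsub, card_image_of_injective _ hwinj, card_univ,
    Fintype.card_fin, nsmul_eq_mul, hcard, zero_mul, zero_add]
  · refine sum_eq_zero fun j _ => pairProd_eq_zero_of_mem (j := j) ?_
    by_cases h : x j ∈ A
    · simp [hw, h]
    · simp [hw, h, h1 j h]
  · intro e he
    simp only [mem_sdiff, mem_image, mem_univ, true_and, not_exists] at he
    refine pairProd_insert_of_notMem ?_ ?_
    · rintro j rfl
      exact he.2 j (by simp [hw, he.1.2])
    · rintro j rfl
      have : x j ∈ A := by
        by_contra h
        exact he.1.2 (h1 j h)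
      exact he.2 j (by simp [hw, this])

end InclusionMatrix

/-! ### The rank criterion and the matrix `M_G^{↑0}`. -/

theorem hasFullRowRank_iff {F r c : Type*} [Field F] [Fintype r] [Fintype c] (M : Matrix r c F) :
    HasFullRowRank M ↔ ∀ y : r → F, Matrix.vecMul y M = 0 → y = 0 := by
  rw [HasFullRowRank, M.rank_eq_finrank_span_row, eq_comm]
  have h := linearIndependent_iff_card_eq_finrank_span (R := F) (b := M.row)
  rw [Set.finrank] at h
  rw [← h, ← Matrix.vecMul_injective_iff]
  exact injective_iff_map_eq_zero M.vecMulLinear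

/-- Extension of a function on `a`-subsets by zero. -/
def extendSubsets {F : Type*} [Field F] {r a : ℕ} (y : Subsets r a → F) (C : Finset (Fin r)) : F :=
  if h : C.card = a then y ⟨C, h⟩ else 0

theorem vecMul_inclusionMatrix {F : Type*} [Field F] {r b : ℕ} (y : Subsets r (b + 1) → F)
    (A : Subsets r b) :
    Matrix.vecMul y (inclusionMatrix F r (b + 1) b) A =
      ∑ e ∈ univ \ A.1, extendSubsets y (insert e A.1) := by
  have hcard : ∀ e ∈ univ \ A.1, (insert e A.1).card = b + 1 := fun e he => by
    rw [card_insert_of_notMem (mem_sdiff.1 he).2, A.2]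
  simp only [Matrix.vecMul, dotProduct, inclusionMatrix, Matrix.of_apply, mul_ite, mul_one,
    mul_zero]
  rw [← sum_filter]
  symm
  refine sum_bij (fun e he => ⟨insert e A.1, hcard e he⟩) ?_ ?_ ?_ ?_
  · intro e he
    simp
  · intro e he e' he' h
    have h' : insert e A.1 = insert e' A.1 := congrArg Subtype.val h
    have : e ∈ insert e' A.1 := h' ▸ mem_insert_self e A.1
    exact (mem_insert.1 this).resolve_right (mem_sdiff.1 he).2
  · rintro ⟨C, hC⟩ hAC
    simp only [mem_filter, mem_univ, true_and] at hAC
    obtain ⟨e, he⟩ := card_eq_one.1 (show (C \ A.1).card = 1 by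
      rw [card_sdiff_of_subset hAC, hC, A.2]; omega)
    have heC : e ∈ C \ A.1 := he ▸ mem_singleton_self e
    refine ⟨e, mem_sdiff.2 ⟨mem_univ _, (mem_sdiff.1 heC).2⟩, Subtype.ext ?_⟩
    change insert e A.1 = C
    rw [insert_eq, ← he, sdiff_union_of_subset hAC]
  · intro e he
    rw [extendSubsets, dif_pos (hcard e he)]

theorem cast_ne_zero_of_lt_char {F : Type*} [Field F] (p : ℕ) [CharP F p] {i : ℕ} (h0 : 0 < i)
    (hi : i < p) : (i : F) ≠ 0 := by
  rw [Ne, CharP.cast_eq_zero_iff F p]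
  exact fun h => absurd (Nat.le_of_dvd h0 h) (by omega)

theorem inclusionMatrix_hasFullRowRank_iff {F : Type*} [Field F] [Finite F] (p : ℕ) [CharP F p]
    {m b : ℕ} (hm : m = 2 * b + 1) :
    HasFullRowRank (inclusionMatrix F m (b + 1) b) ↔ b + 2 ≤ p := by
  rw [hasFullRowRank_iff]
  constructor
  · intro h
    by_contra hp
    have hp0 : 0 < p := (CharP.char_ne_zero_of_finite F p).bot_lt
    -- This number of pairs makes the count `m - b - i` of the equal terms exactly `p`.
    obtain ⟨i, hi⟩ : ∃ i, i + p = b + 1 := ⟨b + 1 - p, by omega⟩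
    let x : Fin i → Fin m := fun j => ⟨2 * j.1, by omega⟩
    let z : Fin i → Fin m := fun j => ⟨2 * j.1 + 1, by omega⟩
    have hx : Function.Injective x := fun j l h => by
      have := congrArg Fin.val h
      simp only [x] at this
      exact Fin.ext (by omega)
    have hz : Function.Injective z := fun j l h => by
      have := congrArg Fin.val h
      simp only [z] at this
      exact Fin.ext (by omega)
    have hxz : ∀ j l, x j ≠ z l := fun j l h => by
      have := congrArg Fin.val h
      simp only [x, z] at this
      omega
    have hy := h (fun C => pairProd x z C.1) (by
      ext A
      rw [vecMul_inclusionMatrix, Pi.zero_apply, sum_congr rfl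
        (g := fun e => (pairProd x z (insert e A.1) : F))]
      · refine sum_pairProd_insert hx hz hxz (fun _ => mem_univ _) (fun _ => mem_univ _) ?_
        rw [card_sdiff_of_subset (subset_univ _), A.2, card_univ, Fintype.card_fin,
          show m - b - i = p by omega]
        exact CharP.cast_eq_zero F p
      · intro e he
        rw [extendSubsets, dif_pos]
        rw [card_insert_of_notMem (mem_sdiff.1 he).2, A.2])
    -- A set with every `x j` and no `z j`, on which the product is `1`.
    obtain ⟨C, hxC, hCz, hC⟩ := exists_subsuperset_card_eq
      (s := univ.image x) (t := univ \ univ.image z) (n := b + 1)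
      (fun a ha => by
        obtain ⟨j, _, rfl⟩ := mem_image.1 ha
        simp [fun l => (hxz j l).symm])
      (by rw [card_image_of_injective _ hx, card_univ, Fintype.card_fin]; omega)
      (by
        rw [card_sdiff_of_subset (subset_univ _), card_image_of_injective _ hz, card_univ,
          card_univ, Fintype.card_fin, Fintype.card_fin]
        omega)
    have h0 := congrFun hy ⟨C, hC⟩
    simp only [pairProd, Pi.zero_apply, prod_eq_zero_iff] at h0
    obtain ⟨j, _, hj⟩ := h0
    have h1 : x j ∈ C := hxC (mem_image_of_mem x (mem_univ j))
    have h2 : z j ∉ C := fun hc => (mem_sdiff.1 (hCz hc)).2 (mem_image_of_mem z (mem_univ j))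
    simp [h1, h2] at hj
  · intro hp y hy
    ext C
    have := eq_zero_of_sum_insert_eq_zero (R := (univ : Finset (Fin m))) (n := b + 1)
      (y := extendSubsets y) (by rw [card_univ, Fintype.card_fin]; omega)
      (fun i h0 hi => cast_ne_zero_of_lt_char p h0 (by omega))
      (fun A _ hA => by
        rw [← vecMul_inclusionMatrix y ⟨A, by omega⟩, hy, Pi.zero_apply])
      (subset_univ C.1) C.2
    rwa [extendSubsets, dif_pos C.2] at this

/-- The columns `(∅, A)` of `M_G^{↑0}` correspond to the `(k - 2)`-subsets `A`. -/
def colIndexZeroEquiv (m k : ℕ) : ColIndex m k 0 ≃ Subsets m (k - 2) where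
  toFun UA := ⟨UA.1.2, UA.2.2.1⟩
  invFun A := ⟨(∅, A.1), card_empty, A.2, by simp⟩
  left_inv UA := Subtype.ext (Prod.ext (card_eq_zero.1 UA.2.1).symm rfl)
  right_inv _ := rfl

theorem arcMatrix_zero {F : Type*} [Field F] {m k : ℕ} (G : Fin m → (Fin k → F))
    (B : Module.Basis (Fin k) F (Fin k → F)) :
    arcMatrix G B 0 =
      (inclusionMatrix F m (k - 1) (k - 2)).submatrix id (colIndexZeroEquiv m k) := by
  ext C UA
  have h0 : UA.1.1 = ∅ := card_eq_zero.1 UA.2.1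
  simp [arcMatrix, inclusionMatrix, colIndexZeroEquiv, h0]

/-! ### Lagrange interpolation over a finite field. -/

section Lagrange

open Polynomial

variable {ι F : Type*} [DecidableEq ι] [Field F] [Fintype F]

theorem prod_erase_sub_eq_neg_one [DecidableEq F] (x : F) :
    ∏ l ∈ univ.erase x, (x - l) = -1 := by
  have h1 := congrArg (Units.val : Fˣ → F) (FiniteField.prod_univ_units_id_eq_neg_one (K := F))
  rw [Units.coe_prod, Units.val_neg, Units.val_one] at h1
  rw [← h1]
  symm
  refine prod_bij (fun u _ => x - u.1) ?_ ?_ ?_ ?_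
  · intro u _
    simp
  · intro u _ v _ h
    exact Units.ext (sub_right_injective h)
  · intro l hl
    refine ⟨Units.mk0 (x - l) (sub_ne_zero.2 (mem_erase.1 hl).1.symm), mem_univ _, ?_⟩
    simp
  · intro u _
    simp

/-- By Wilson's theorem the inverse of the product over `S` is `-T(a e)`, where `T` has the field
elements outside `a(S)` as simple roots. The sum is then minus the coefficient of `X ^ (E.card - 1)`
in `T`, zero since `T` has degree `q - S.card`. -/
theorem sum_inv_prod_sub_mul_prod_sub_eq_zero {S E : Finset ι} (hES : E ⊆ S) {a : ι → F}
    (ha : Set.InjOn a S) (hcard : Fintype.card F + 1 < S.card + E.card) :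
    ∑ e ∈ E, ((∏ u ∈ S.erase e, (a e - a u)) * ∏ u ∈ E.erase e, (a e - a u))⁻¹ = 0 := by
  classical
  let T : F[X] := ∏ l ∈ univ \ S.image a, (X - C l)
  have hle : S.card ≤ Fintype.card F := by
    rw [← card_image_of_injOn ha]
    exact card_le_univ _
  have hdeg : T.natDegree = Fintype.card F - S.card := by
    rw [natDegree_prod_of_monic _ _ fun l _ => monic_X_sub_C l]
    simp [card_sdiff_of_subset, card_image_of_injOn ha]
  have hTS : ∀ e ∈ S, T.eval (a e) * ∏ u ∈ S.erase e, (a e - a u) = -1 := by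
    intro e he
    rw [← prod_erase_sub_eq_neg_one (a e)]
    have hsub : (S.image a).erase (a e) ⊆ univ.erase (a e) := erase_subset_erase _ (subset_univ _)
    have h1 : (S.image a).erase (a e) = (S.erase e).image a := by
      ext l
      simp only [mem_erase, mem_image]
      constructor
      · rintro ⟨h, u, hu, rfl⟩
        exact ⟨u, ⟨fun h' => h (h' ▸ rfl), hu⟩, rfl⟩
      · rintro ⟨u, ⟨h, hu⟩, rfl⟩
        exact ⟨fun h' => h (ha hu he h'), u, hu, rfl⟩
    have h2 : univ.erase (a e) \ (S.image a).erase (a e) = univ \ S.image a := by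
      ext l
      have : a e ∈ S.image a := mem_image_of_mem a he
      simp only [mem_sdiff, mem_erase, mem_univ]
      constructor
      · rintro ⟨⟨h, _⟩, h'⟩
        exact ⟨trivial, fun h'' => h' ⟨h, h''⟩⟩
      · rintro ⟨_, h⟩
        exact ⟨⟨fun h' => h (h' ▸ this), trivial⟩, fun h' => h h'.2⟩
    rw [← prod_sdiff hsub, h1, prod_image (ha.mono (coe_subset.2 (erase_subset _ _))), ← h1, h2,
      eval_prod]
    simp
  have hL := Lagrange.coeff_eq_sum (ha.mono (coe_subset.2 hES)) (P := T)
    (by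
      rw [degree_eq_natDegree (prod_ne_zero_iff.2 fun l _ => X_sub_C_ne_zero l), hdeg]
      exact_mod_cast (by omega))
  rw [coeff_eq_zero_of_natDegree_lt (by omega)] at hL
  rw [← neg_eq_zero, hL, ← sum_neg_distrib]
  refine sum_congr rfl fun e he => ?_
  have h := hTS e (hES he)
  have h0 : ∏ u ∈ S.erase e, (a e - a u) ≠ 0 := fun h0 => by simp [h0] at h
  rw [eq_div_of_mul_eq h0 h, mul_inv]
  field_simp

end Lagrange

/-- The scalars do not matter: the cardinality condition makes `κ * d e` occur to the power `q`, and
`x ^ q = x`, so with the extra `d e` all terms share one constant factor. -/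
theorem sum_inv_bracket_eq_zero {ι F : Type*} [DecidableEq ι] [Field F] [Fintype F]
    {S E : Finset ι} (hES : E ⊆ S) {a d : ι → F} {κ : F} {b : ι → ι → F}
    (ha : Set.InjOn a S) (hb : ∀ u ∈ S, ∀ v ∈ S, b u v = κ * d u * d v * (a v - a u))
    (hcard : S.card + E.card = Fintype.card F + 2) :
    ∑ e ∈ E, (d e * (∏ u ∈ S.erase e, b u e) * ∏ u ∈ E.erase e, b u e)⁻¹ = 0 := by
  have key : ∀ T : Finset ι, T ⊆ S → ∀ e ∈ T, ∏ u ∈ T.erase e, b u e =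
      (κ * d e) ^ (T.card - 1) * (∏ u ∈ T.erase e, d u) * ∏ u ∈ T.erase e, (a e - a u) := by
    intro T hT e he
    rw [← card_erase_of_mem he, ← prod_const, ← prod_mul_distrib, ← prod_mul_distrib]
    refine prod_congr rfl fun u hu => ?_
    rw [hb u (hT (mem_of_mem_erase hu)) e (hT he)]
    ring
  have hterm : ∀ e ∈ E, (d e * (∏ u ∈ S.erase e, b u e) * ∏ u ∈ E.erase e, b u e)⁻¹ =
      (κ * (∏ u ∈ S, d u) * ∏ u ∈ E, d u)⁻¹ *
        ((∏ u ∈ S.erase e, (a e - a u)) * ∏ u ∈ E.erase e, (a e - a u))⁻¹ := by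
    intro e he
    have h1 : 0 < E.card := card_pos.2 ⟨e, he⟩
    have h2 : 0 < S.card := card_pos.2 ⟨e, hES he⟩
    have hpow : (κ * d e) ^ (S.card - 1) * (κ * d e) ^ (E.card - 1) = κ * d e := by
      rw [← pow_add, show S.card - 1 + (E.card - 1) = Fintype.card F by omega,
        FiniteField.pow_card]
    rw [key S subset_rfl e (hES he), key E hES e he, ← mul_inv, ← mul_prod_erase S d (hES he),
      ← mul_prod_erase E d he]
    congr 1
    linear_combination (d e * (∏ u ∈ S.erase e, d u) * (∏ u ∈ S.erase e, (a e - a u)) *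
      (∏ u ∈ E.erase e, d u) * ∏ u ∈ E.erase e, (a e - a u)) * hpow
  rw [sum_congr rfl hterm, ← mul_sum,
    sum_inv_prod_sub_mul_prod_sub_eq_zero hES ha (by omega), mul_zero]

/-! ### Determinants with a fixed tail and the Plücker relation. -/

section Bracket

variable {F : Type*} [Field F]

/-- The determinant as an alternating map in the last `n` rows, with first row `u`. -/
def detCons {n : ℕ} (u : Fin (n + 1) → F) : (Fin (n + 1) → F) [⋀^Fin n]→ₗ[F] F :=
  (Matrix.detRowAlternating : (Fin (n + 1) → F) [⋀^Fin (n + 1)]→ₗ[F] F).curryLeft u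

theorem detCons_apply {n : ℕ} (u : Fin (n + 1) → F) (w : Fin n → Fin (n + 1) → F) :
    detCons u w = Matrix.det (Matrix.of (Matrix.vecCons u w)) := rfl

/-- `det (u, v, w)` as a linear form in `u`. -/
def bracket {n : ℕ} (w : Fin n → Fin (n + 2) → F) (v : Fin (n + 2) → F) :
    (Fin (n + 2) → F) →ₗ[F] F where
  toFun u := detCons u (Matrix.vecCons v w)
  map_add' u u' := by simp [detCons]
  map_smul' c u := by simp [detCons]

theorem bracket_apply {n : ℕ} (w : Fin n → Fin (n + 2) → F) (v u : Fin (n + 2) → F) :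
    bracket w v u = detCons u (Matrix.vecCons v w) := rfl

theorem bracket_self {n : ℕ} (w : Fin n → Fin (n + 2) → F) (v : Fin (n + 2) → F) :
    bracket w v v = 0 :=
  (Matrix.detRowAlternating (R := F)).map_eq_zero_of_eq
    (Matrix.vecCons v (Matrix.vecCons v w)) (i := 0) (j := 1) rfl (by simp)

theorem bracket_tail {n : ℕ} (w : Fin n → Fin (n + 2) → F) (v : Fin (n + 2) → F) (i : Fin n) :
    bracket w v (w i) = 0 :=
  (Matrix.detRowAlternating (R := F)).map_eq_zero_of_eq
    (Matrix.vecCons (w i) (Matrix.vecCons v w)) (i := 0) (j := i.succ.succ) rfl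
    (Fin.succ_ne_zero _).symm

theorem bracket_swap {n : ℕ} (w : Fin n → Fin (n + 2) → F) (u v : Fin (n + 2) → F) :
    bracket w u v = -bracket w v u := by
  have h := (Matrix.detRowAlternating (R := F)).map_swap
    (Matrix.vecCons u (Matrix.vecCons v w)) (i := 0) (j := 1) (by simp)
  rw [bracket_apply, bracket_apply]
  refine Eq.trans ?_ h
  change Matrix.detRowAlternating _ = _
  congr 1
  funext i
  refine Fin.cases ?_ (fun i => Fin.cases ?_ (fun i => ?_) i) i
  · simp
  · simp
  · have h1 : (i.succ.succ : Fin (n + 2)) ≠ 0 := Fin.succ_ne_zero _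
    have h2 : (i.succ.succ : Fin (n + 2)) ≠ 1 := by
      rw [← Fin.succ_zero_eq_one]
      exact fun h => Fin.succ_ne_zero _ (Fin.succ_injective _ h)
    simp [Equiv.swap_apply_of_ne_of_ne h1 h2]

/-- The three-term Plücker relation. -/
theorem bracket_mul_bracket {n : ℕ} (w : Fin n → Fin (n + 2) → F) {s t : Fin (n + 2) → F}
    (hst : bracket w t s ≠ 0) (u v : Fin (n + 2) → F) :
    bracket w t s * bracket w v u =
      bracket w u s * bracket w v t - bracket w v s * bracket w u t := by
  have hspan : Submodule.span F (Set.range (Matrix.vecCons s (Matrix.vecCons t w))) = ⊤ := by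
    have hli : LinearIndependent F (Matrix.vecCons s (Matrix.vecCons t w)) :=
      Matrix.linearIndependent_rows_iff_isUnit.2
        ((Matrix.isUnit_iff_isUnit_det _).2 (isUnit_iff_ne_zero.2 hst))
    exact hli.span_eq_top_of_card_eq_finrank' (by simp)
  -- Both sides are linear forms, so it suffices to compare them on the basis `s, t, w`.
  have h : bracket w t s • bracket w v =
      bracket w v s • bracket w t - bracket w v t • bracket w s := by
    refine LinearMap.ext_on_range hspan fun i => ?_
    refine Fin.cases ?_ (fun i => Fin.cases ?_ (fun i => ?_) i) i
    · simp [bracket_self, mul_comm]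
    · simp [bracket_self, bracket_swap w s t, mul_comm]
    · simp [bracket_tail]
  have h' := LinearMap.congr_fun h u
  simp only [LinearMap.smul_apply, LinearMap.sub_apply, smul_eq_mul] at h'
  rw [h', bracket_swap w t u, bracket_swap w s u]
  ring

end Bracket

/-! ### The weights of an arc of size `q + 2`. -/

theorem comp_vecCons {α β : Type*} {n : ℕ} (f : α → β) (x : α) (c : Fin n → α) :
    f ∘ Matrix.vecCons x c = Matrix.vecCons (f x) (f ∘ c) :=
  funext fun i => Fin.cases rfl (fun _ => rfl) i

theorem vecCons_injective {α : Type*} {n : ℕ} {x : α} {c : Fin n → α} (hc : Function.Injective c)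
    (hx : ∀ i, c i ≠ x) : Function.Injective (Matrix.vecCons x c) :=
  Fin.cons_injective_iff.2 ⟨fun ⟨i, hi⟩ => hx i hi, hc⟩

theorem image_vecCons {α : Type*} [DecidableEq α] {n : ℕ} (x : α) (c : Fin n → α) :
    univ.image (Matrix.vecCons x c) = insert x (univ.image c) := by
  ext y
  simp [Fin.exists_fin_succ, eq_comm]

theorem detCons_ne_zero {ι F : Type*} [DecidableEq ι] [Field F] {j : ℕ} {S : ι → Fin (j + 2) → F}
    (hS : ∀ c : Fin (j + 2) → ι, Function.Injective c → Matrix.det (Matrix.of (S ∘ c)) ≠ 0)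
    {c : Fin (j + 1) → ι} (hc : Function.Injective c) {u : ι} (hu : u ∉ univ.image c) :
    detCons (S u) (S ∘ c) ≠ 0 := by
  rw [detCons_apply, ← comp_vecCons]
  refine hS _ (vecCons_injective hc ?_)
  rintro i rfl
  exact hu (mem_image_of_mem c (mem_univ i))

section Relation

variable {ι F : Type*} [Fintype ι] [LinearOrder ι] [Field F]

/-- The product of `det (u, c)` over the `u` outside `c`, counted twice for `u ∈ G`. -/
def detProd {n : ℕ} (S : ι → Fin (n + 1) → F) (G : Finset ι) (c : Fin n → ι) : F :=
  (∏ u ∈ univ \ univ.image c, detCons (S u) (S ∘ c)) *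
    ∏ u ∈ G \ univ.image c, detCons (S u) (S ∘ c)

/-- There are `q + 1` factors in all, and the sign `ε` satisfies `ε ^ (q + 1) = ε ^ 2 = 1`; hence
the weight depends only on the set. -/
theorem detProd_comp_perm [Fintype F] {n : ℕ} (S : ι → Fin (n + 1) → F) {G : Finset ι}
    {c : Fin n → ι} (hcG : univ.image c ⊆ G) (hc : Function.Injective c)
    (hcard : Fintype.card ι + G.card = Fintype.card F + 1 + 2 * n) (σ : Equiv.Perm (Fin n)) :
    detProd S G (c ∘ σ) = detProd S G c := by
  have himg : univ.image (c ∘ σ) = univ.image c := by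
    ext x
    simp only [mem_image, mem_univ, true_and, Function.comp_apply]
    exact (σ.surjective.exists (p := fun i => c i = x)).symm
  have hdet : ∀ u, detCons (S u) (S ∘ c ∘ σ) =
      ((Equiv.Perm.sign σ : ℤ) : F) * detCons (S u) (S ∘ c) := by
    intro u
    rw [← Function.comp_assoc, AlternatingMap.map_perm, Units.smul_def, zsmul_eq_mul]
  have hcc : (univ.image c).card = n := by
    rw [card_image_of_injective _ hc, card_univ, Fintype.card_fin]
  have h1 := card_le_card hcG
  have hG := card_le_univ G
  have hsq : ((Equiv.Perm.sign σ : ℤ) : F) * ((Equiv.Perm.sign σ : ℤ) : F) = 1 := by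
    rw [← Int.cast_mul, Int.units_coe_mul_self, Int.cast_one]
  have hpow : ((Equiv.Perm.sign σ : ℤ) : F) ^ (univ \ univ.image c).card *
      ((Equiv.Perm.sign σ : ℤ) : F) ^ (G \ univ.image c).card = 1 := by
    rw [← pow_add, card_sdiff_of_subset (subset_univ _), card_sdiff_of_subset hcG, hcc, card_univ,
      show Fintype.card ι - n + (G.card - n) = Fintype.card F + 1 by omega, pow_succ,
      FiniteField.pow_card, hsq]
  rw [detProd, himg]
  simp only [hdet]
  rw [prod_mul_distrib, prod_mul_distrib, prod_const, prod_const, detProd]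
  linear_combination ((∏ u ∈ univ \ univ.image c, detCons (S u) (S ∘ c)) *
    ∏ u ∈ G \ univ.image c, detCons (S u) (S ∘ c)) * hpow

/-- The inverse of `detProd` as a function of `n`-subsets. -/
def detWeight {n : ℕ} (S : ι → Fin (n + 1) → F) (G : Finset ι) (C : Finset ι) : F :=
  if h : C.card = n then (detProd S G (C.orderEmbOfFin h))⁻¹ else 0

theorem detWeight_image [Fintype F] {n : ℕ} (S : ι → Fin (n + 1) → F) {G : Finset ι}
    {c : Fin n → ι} (hcG : univ.image c ⊆ G) (hc : Function.Injective c)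
    (hcard : Fintype.card ι + G.card = Fintype.card F + 1 + 2 * n) :
    detWeight S G (univ.image c) = (detProd S G c)⁻¹ := by
  have hcc : (univ.image c).card = n := by
    rw [card_image_of_injective _ hc, card_univ, Fintype.card_fin]
  rw [detWeight, dif_pos hcc]
  have hex : ∀ i, ∃ l, (univ.image c).orderEmbOfFin hcc l = c i := fun i => by
    have h : c i ∈ Set.range ((univ.image c).orderEmbOfFin hcc) := by
      rw [range_orderEmbOfFin]
      exact mem_coe.2 (mem_image_of_mem c (mem_univ i))
    exact h
  choose τ hτ using hex
  have hinj : Function.Injective τ := fun i l h => hc (by rw [← hτ, ← hτ, h])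
  let σ : Equiv.Perm (Fin n) := Equiv.ofBijective τ (Finite.injective_iff_bijective.1 hinj)
  have hσ : c = (univ.image c).orderEmbOfFin hcc ∘ σ := funext fun i => (hτ i).symm
  congr 1
  conv_rhs => rw [hσ]
  exact (detProd_comp_perm S (by rwa [image_orderEmbOfFin_univ])
    (RelEmbedding.injective _) hcard σ).symm

variable {j : ℕ} {S : ι → Fin (j + 2) → F}

theorem sum_inv_detProd_eq_zero [Fintype F]
    (hS : ∀ c : Fin (j + 2) → ι, Function.Injective c → Matrix.det (Matrix.of (S ∘ c)) ≠ 0)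
    (hι : Fintype.card ι = Fintype.card F + 2) {G : Finset ι} (hG : G.card = 2 * j + 1)
    {s : ι} (hs : s ∉ G) {c : Fin j → ι} (hc : Function.Injective c) (hcG : univ.image c ⊆ G) :
    ∑ e ∈ G \ univ.image c, (detProd S G (Matrix.vecCons e c))⁻¹ = 0 := by
  set A := univ.image c with hA
  have hAc : A.card = j := by
    rw [hA, card_image_of_injective _ hc, card_univ, Fintype.card_fin]
  set E := G \ A with hE
  set T := (univ \ A).erase s with hT
  have hEc : E.card = j + 1 := by rw [hE, card_sdiff_of_subset hcG]; omega
  have hsA : s ∉ A := fun h => hs (hcG h)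
  have hTc : T.card + j = Fintype.card F + 1 := by
    have : j ≤ Fintype.card ι := hAc ▸ card_le_univ A
    rw [hT, card_erase_of_mem (mem_sdiff.2 ⟨mem_univ _, hsA⟩),
      card_sdiff_of_subset (subset_univ _), card_univ]
    have := card_le_univ G
    omega
  have hET : E ⊆ T := fun e he => by
    rw [hE, mem_sdiff] at he
    rw [hT, mem_erase, mem_sdiff]
    exact ⟨fun h => hs (h ▸ he.1), mem_univ _, he.2⟩
  have hTmem : ∀ u ∈ T, u ≠ s ∧ u ∉ A := fun u hu => by
    rw [hT, mem_erase, mem_sdiff] at hu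
    exact ⟨hu.1, hu.2.2⟩
  have hbr : ∀ u v, u ∉ A → v ∉ A → u ≠ v → bracket (S ∘ c) (S v) (S u) ≠ 0 := by
    intro u v hu hv huv
    rw [bracket_apply, ← comp_vecCons]
    refine detCons_ne_zero hS (vecCons_injective hc ?_) ?_
    · rintro i rfl
      exact hv (mem_image_of_mem c (mem_univ i))
    · rw [image_vecCons, mem_insert, not_or]
      exact ⟨huv, hu⟩
  obtain ⟨t, ht⟩ : E.Nonempty := card_pos.1 (by omega)
  have htT := hTmem t (hET ht)
  have hst := hbr s t hsA htT.2 htT.1.symm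
  -- Modulo the span of `S ∘ c` the vectors give points of a projective line; `a` is the affine
  -- coordinate with `s` at infinity and `t` at the origin.
  set d : ι → F := fun v => bracket (S ∘ c) (S v) (S s) with hd
  set a : ι → F := fun v => bracket (S ∘ c) (S v) (S t) / d v with ha
  have hd0 : ∀ u ∈ T, d u ≠ 0 := fun u hu => hbr s u hsA (hTmem u hu).2 (hTmem u hu).1.symm
  have hb : ∀ u ∈ T, ∀ v ∈ T, bracket (S ∘ c) (S v) (S u) =
      (bracket (S ∘ c) (S t) (S s))⁻¹ * d u * d v * (a v - a u) := by
    intro u hu v hv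
    have h1 := hd0 u hu
    have h2 := hd0 v hv
    have h := bracket_mul_bracket (S ∘ c) hst (S u) (S v)
    rw [mul_assoc, mul_assoc, eq_inv_mul_iff_mul_eq₀ hst, h]
    simp only [ha]
    field_simp
    simp only [hd]
    ring
  have hinj : Set.InjOn a T := by
    intro u hu v hv huv
    by_contra hne
    refine hbr u v (hTmem u hu).2 (hTmem v hv).2 hne ?_
    rw [hb u hu v hv, huv, sub_self, mul_zero]
  -- The sizes `q + 1 - j` of `T` and `j + 1` of `E` add up to `q + 2`; the factor `d e` is the
  -- contribution of `u = s`.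
  rw [← sum_inv_bracket_eq_zero hET hinj hb (by omega)]
  refine sum_congr rfl fun e he => ?_
  have heT := hTmem e (hET he)
  rw [detProd, image_vecCons, comp_vecCons]
  congr 2
  · have h1 : univ \ insert e A = insert s (T.erase e) := by
      ext x
      simp only [hT, mem_sdiff, mem_univ, true_and, mem_insert, mem_erase, not_or]
      constructor
      · rintro ⟨hxe, hxA⟩
        by_cases hxs : x = s
        · exact Or.inl hxs
        · exact Or.inr ⟨hxe, hxs, hxA⟩
      · rintro (rfl | ⟨h1, _, h3⟩)
        · exact ⟨heT.1.symm, hsA⟩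
        · exact ⟨h1, h3⟩
    rw [← hA, h1, prod_insert (by simp [hT])]
    rfl
  · have h1 : G \ insert e A = E.erase e := by
      ext x
      simp only [hE, mem_sdiff, mem_insert, mem_erase, not_or]
      tauto
    rw [← hA, h1]
    rfl

/-- There is no arc of size `q + 2` in `F ^ k` if `k ≤ p` and `2 k ≤ q + 4`. -/
theorem not_arc_of_le_char [Fintype F] (p : ℕ) [CharP F p] (hp : j + 2 ≤ p)
    (hS : ∀ c : Fin (j + 2) → ι, Function.Injective c → Matrix.det (Matrix.of (S ∘ c)) ≠ 0)
    (hι : Fintype.card ι = Fintype.card F + 2) (hj : 2 * j ≤ Fintype.card F) : False := by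
  obtain ⟨G, _, hG⟩ := exists_subset_card_eq (s := (univ : Finset ι)) (n := 2 * j + 1)
    (by rw [card_univ]; omega)
  obtain ⟨s, hs⟩ : ∃ s, s ∉ G := by
    by_contra! h
    have : G = univ := eq_univ_of_forall h
    rw [this, card_univ] at hG
    omega
  have hcard : Fintype.card ι + G.card = Fintype.card F + 1 + 2 * (j + 1) := by omega
  obtain ⟨C, hCG, hC⟩ := exists_subset_card_eq (s := G) (n := j + 1) (by omega)
  have h0 := eq_zero_of_sum_insert_eq_zero (F := F) (R := G) (n := j + 1) (y := detWeight S G)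
    (by omega) (fun i h0 hi => cast_ne_zero_of_lt_char p h0 (by omega)) (fun A hAG hA => by
      have hA' : A.card = j := by omega
      have himg : univ.image (A.orderEmbOfFin hA') = A := image_orderEmbOfFin_univ A hA'
      have h := sum_inv_detProd_eq_zero hS hι hG hs (c := A.orderEmbOfFin hA')
        (RelEmbedding.injective _) (by rwa [himg])
      rw [himg] at h
      rw [← h]
      refine sum_congr rfl fun e he => ?_
      rw [mem_sdiff] at he
      have hinj : Function.Injective (Matrix.vecCons e (A.orderEmbOfFin hA')) :=
        vecCons_injective (RelEmbedding.injective _) fun i hi =>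
          he.2 (hi ▸ orderEmbOfFin_mem A hA' i)
      rw [← detWeight_image S (by rw [image_vecCons, himg]; exact insert_subset he.1 hAG) hinj
        hcard, image_vecCons, himg]) hCG hC
  rw [detWeight, dif_pos hC, inv_eq_zero, detProd, mul_eq_zero, prod_eq_zero_iff,
    prod_eq_zero_iff] at h0
  rcases h0 with ⟨u, hu, h0⟩ | ⟨u, hu, h0⟩
  · exact detCons_ne_zero hS (RelEmbedding.injective _) (mem_sdiff.1 hu).2 h0
  · exact detCons_ne_zero hS (RelEmbedding.injective _) (mem_sdiff.1 hu).2 h0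

end Relation

/-! ### Duality, the normal rational curve and the bound. -/

variable {F : Type*} [Field F]

theorem det_ne_zero_iff_linearIndependent {k : ℕ} (v : Fin k → Fin k → F) :
    Matrix.det (Matrix.of v) ≠ 0 ↔ LinearIndependent F v := by
  rw [← isUnit_iff_ne_zero, ← Matrix.isUnit_iff_isUnit_det]
  exact Matrix.linearIndependent_rows_iff_isUnit.symm

theorem isArc_iff_det_ne_zero {m k : ℕ} (G : Fin m → Fin k → F) :
    IsArc G ↔ k ≤ m ∧ ∀ c : Fin k → Fin m, Function.Injective c →
      Matrix.det (Matrix.of (G ∘ c)) ≠ 0 := by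
  refine and_congr_right fun _ => ⟨fun h c hc => ?_, fun h T hT => ?_⟩
  · rw [det_ne_zero_iff_linearIndependent]
    have hli := (h (univ.image c)
      (by rw [card_image_of_injective _ hc, card_univ, Fintype.card_fin])).1
    exact hli.comp (fun i => ⟨c i, mem_image_of_mem c (mem_univ i)⟩)
      fun i l hil => hc (congrArg Subtype.val hil)
  · have hli := (det_ne_zero_iff_linearIndependent _).1
      (h (T.orderEmbOfFin hT) (RelEmbedding.injective _))
    have hli' : LinearIndependent F (fun i : T => G i) := by
      rw [← linearIndependent_equiv (T.orderIsoOfFin hT).toEquiv]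
      exact hli
    exact ⟨hli', hli'.span_eq_top_of_card_eq_finrank' (by simp [hT])⟩

theorem IsArc.castLE {m m' k : ℕ} {G : Fin m → Fin k → F} (hG : IsArc G) (hk : k ≤ m')
    (hm : m' ≤ m) : IsArc (G ∘ Fin.castLE hm) := by
  rw [isArc_iff_det_ne_zero] at hG ⊢
  exact ⟨hk, fun c hc => hG.2 (Fin.castLE hm ∘ c) ((Fin.castLE_injective hm).comp hc)⟩

/-- The dual of an arc. -/
theorem IsArc.exists_dual {k l : ℕ} {G : Fin (k + l) → Fin k → F} (hG : IsArc G) :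
    ∃ H : Fin (k + l) → Fin l → F, IsArc H := by
  let f : (Fin (k + l) → F) →ₗ[F] (Fin k → F) := Fintype.linearCombination F G
  have hsurj : LinearMap.range f = ⊤ := by
    rw [Fintype.range_linearCombination, eq_top_iff,
      ← (hG.2 (univ.image (Fin.castAdd l)) (by
        rw [card_image_of_injective _ (Fin.castAdd_injective k l), card_univ,
          Fintype.card_fin])).2]
    refine Submodule.span_mono ?_
    rintro _ ⟨i, rfl⟩
    exact ⟨i, rfl⟩
  have hker : Module.finrank F (LinearMap.ker f) = l := by
    have := f.finrank_range_add_finrank_ker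
    rw [hsurj, finrank_top, Module.finrank_fin_fun, Module.finrank_fin_fun] at this
    omega
  let b : Module.Basis (Fin l) F (LinearMap.ker f) :=
    (Module.finBasis F (LinearMap.ker f)).reindex (finCongr hker)
  refine ⟨fun i r => (b r : Fin (k + l) → F) i, ?_⟩
  rw [isArc_iff_det_ne_zero]
  refine ⟨Nat.le_add_left l k, fun c hc hzero => ?_⟩
  obtain ⟨x, hx0, hx⟩ := Matrix.exists_mulVec_eq_zero_iff.2 hzero
  refine hx0 ?_
  let w : LinearMap.ker f := ∑ r, x r • b r
  have hwapp : ∀ i, (w : Fin (k + l) → F) i = ∑ r, x r * (b r : Fin (k + l) → F) i := by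
    intro i
    simp [w, Finset.sum_apply]
  have hwc : ∀ i, (w : Fin (k + l) → F) (c i) = 0 := by
    intro i
    rw [hwapp]
    refine Eq.trans ?_ (congrFun hx i)
    simp [Matrix.mulVec, dotProduct, mul_comm]
  -- A linear relation vanishing at `l` positions involves only `k` vectors, which are independent.
  have hw0 : w = 0 := by
    have hTc : (univ \ univ.image c).card = k := by
      rw [card_sdiff_of_subset (subset_univ _), card_image_of_injective _ hc, card_univ, card_univ,
        Fintype.card_fin, Fintype.card_fin]
      omega
    have hli := (hG.2 _ hTc).1
    have hsum : ∑ i : (univ \ univ.image c : Finset (Fin (k + l))),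
        (w : Fin (k + l) → F) i • G i = 0 := by
      have h := LinearMap.mem_ker.1 w.2
      rw [Fintype.linearCombination_apply] at h
      rw [← h, sum_coe_sort (univ \ univ.image c) (fun i => (w : Fin (k + l) → F) i • G i)]
      refine sum_subset (subset_univ _) fun i _ hi => ?_
      simp only [mem_sdiff, mem_univ, true_and, not_not, mem_image] at hi
      obtain ⟨r, rfl⟩ := hi
      rw [hwc, zero_smul]
    have hz := Fintype.linearIndependent_iff.1 hli (fun i => (w : Fin (k + l) → F) i) hsum
    ext i
    by_cases hi : i ∈ univ.image c
    · obtain ⟨r, _, rfl⟩ := mem_image.1 hi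
      exact hwc r
    · exact hz ⟨i, mem_sdiff.2 ⟨mem_univ _, hi⟩⟩
  exact funext (Fintype.linearIndependent_iff.1 b.linearIndependent x hw0)

/-- The normal rational curve, with its point at infinity, is an arc. -/
theorem exists_isArc_card_add_one [Fintype F] {k : ℕ} (hk : k ≤ Fintype.card F + 1) :
    ∃ G : Fin (Fintype.card F + 1) → Fin k → F, IsArc G := by
  let a : Fin (Fintype.card F) ≃ F := (Fintype.equivFin F).symm
  let v : Fin (Fintype.card F + 1) → F := Fin.snoc (α := fun _ => F) a 1
  let w : Fin (Fintype.card F + 1) → F := Fin.snoc (α := fun _ => F) (fun _ => 1) 0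
  have hvw : ∀ i l, i ≠ l → v l * w i - v i * w l ≠ 0 := by
    intro i l
    refine Fin.lastCases ?_ (fun i => ?_) i <;> refine Fin.lastCases ?_ (fun l => ?_) l
    · simp
    · simp [v, w]
    · simp [v, w]
    · intro h h0
      simp only [v, w, Fin.snoc_castSucc, mul_one, sub_eq_zero] at h0
      exact h (congrArg Fin.castSucc (a.injective h0).symm)
  -- At infinity `(v, w) = (1, 0)`, and `0 ^ 0 = 1` gives the last unit vector.
  refine ⟨fun i r => v i ^ r.1 * w i ^ r.rev.1, ?_⟩
  rw [isArc_iff_det_ne_zero]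
  refine ⟨hk, fun c hc => ?_⟩
  change Matrix.det (Matrix.projVandermonde (v ∘ c) (w ∘ c)) ≠ 0
  rw [Matrix.det_projVandermonde]
  refine prod_ne_zero_iff.2 fun i _ => prod_ne_zero_iff.2 fun l hl => ?_
  exact hvw _ _ (hc.ne (mem_Ioi.1 hl).ne)

theorem char_le_card [Fintype F] (p : ℕ) [CharP F p] : p ≤ Fintype.card F :=
  Nat.le_of_dvd Fintype.card_pos
    ((CharP.cast_eq_zero_iff F p _).1 (Nat.cast_card_eq_zero F))

theorem card_le_of_isArc [Fintype F] (p : ℕ) [CharP F p] {m k : ℕ} (hk2 : 2 ≤ k) (hkp : k ≤ p)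
    {G : Fin m → Fin k → F} (hG : IsArc G) : m ≤ Fintype.card F + 1 := by
  by_contra! hm
  have hpq := char_le_card (F := F) p
  have small : ∀ {k : ℕ}, 2 ≤ k → k ≤ p → 2 * k ≤ Fintype.card F + 4 →
      ∀ G : Fin (Fintype.card F + 2) → Fin k → F, ¬ IsArc G := by
    intro k hk2 hkp hk G hG
    obtain ⟨j, rfl⟩ : ∃ j, k = j + 2 := ⟨k - 2, by omega⟩
    exact not_arc_of_le_char p hkp ((isArc_iff_det_ne_zero G).1 hG).2 (by simp) (by omega)
  have hG' := hG.castLE (m' := Fintype.card F + 2) (by omega) (by omega)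
  by_cases h : 2 * k ≤ Fintype.card F + 4
  · exact small hk2 hkp h _ hG'
  -- The dual dimension `l = q + 2 - k` is at least `2` because `k ≤ p ≤ q`, and is less than `k`,
  -- hence at most `p`.
  · obtain ⟨l, hl⟩ : ∃ l, Fintype.card F + 2 = k + l := ⟨Fintype.card F + 2 - k, by omega⟩
    have hsmall := @small l (by omega) (by omega) (by omega)
    rw [hl] at hsmall
    have hle : k + l ≤ m := by omega
    obtain ⟨H, hH⟩ := (hG.castLE (m' := k + l) (by omega) hle).exists_dual
    exact hsmall H hH

end ArcMDS

theorem mainTheorem2 (F : Type*) [Field F] [Fintype F] (p : ℕ) [CharP F p] (k : ℕ) :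
    (∀ (m : ℕ), m + 3 = 2 * k → ∀ (G : Fin m → (Fin k → F)), ArcMDS.IsArc G →
      ∀ B : Module.Basis (Fin k) F (Fin k → F),
        (∃ e : ArcMDS.ColIndex m k 0 ≃ ArcMDS.Subsets m (k - 2),
          (∀ UA, (e UA).1 = UA.1.2) ∧
          ArcMDS.arcMatrix G B 0 =
            (ArcMDS.inclusionMatrix F m (k - 1) (k - 2)).submatrix id e) ∧
        (ArcMDS.HasFullRowRank (ArcMDS.arcMatrix G B 0) ↔ k ≤ p)) ∧
    (2 ≤ k → k ≤ p → IsGreatest (ArcMDS.arcSizes F k) (Fintype.card F + 1)) := by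
  refine ⟨fun m hm G hG B => ⟨⟨ArcMDS.colIndexZeroEquiv m k, fun _ => rfl,
    ArcMDS.arcMatrix_zero G B⟩, ?_⟩, fun hk2 hkp => ⟨?_, ?_⟩⟩
  · obtain ⟨b, rfl⟩ : ∃ b, k = b + 2 := ⟨k - 2, by omega⟩
    rw [← ArcMDS.inclusionMatrix_hasFullRowRank_iff (F := F) p (m := m) (b := b) (by omega),
      ArcMDS.HasFullRowRank, ArcMDS.HasFullRowRank, ArcMDS.arcMatrix_zero]
    exact Eq.congr_left (Matrix.rank_submatrix (ArcMDS.inclusionMatrix F m (b + 1) b)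
      (Equiv.refl _) (ArcMDS.colIndexZeroEquiv m (b + 2)))
  · have := ArcMDS.char_le_card (F := F) p
    exact ArcMDS.exists_isArc_card_add_one (by omega)
  · rintro m ⟨G, hG⟩
    exact ArcMDS.card_le_of_isArc p hk2 hkp hG
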